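/- Conventions. A partition $\tau_n=(n_1,\dots,n_t)$ of a positive integer $n$ consists of positive integers with $n_1+\dots+n_t=n$; every $X\in\mathbb R^{n\times n}$ is partitioned accordingly into blocks $X_{jk}\in\mathbb R^{n_j\times n_k}$. $\mathrm{Bdiag}_{\tau_n}(X)=\mathrm{diag}(X_{11},\dots,X_{tt})$, and $\mathbb D_{\tau_n}$ is the set of $\tau_n$-block diagonal matrices, i.e. those with $X=\mathrm{Bdiag}_{\tau_n}(X)$. $\mathbb P_{\tau_n}$ is the set of permutation matrices $\Pi\in\mathbb R^{n\times n}$ with $\Pi^{\mathsf T}D\Pi\in\mathbb D_{\tau_n}$ for all $D\in\mathbb D_{\tau_n}$. Let $\mathcal A=\{A_i\}_{i=1}^m$ with $A_i\in\mathbb R^{n\times n}$. A $\tau_n$-block diagonalizer of $\mathcal A$ is a nonsingular $W\in\mathbb R^{n\times n}$ with $W^{\mathsf T}A_iW\in\mathbb D_{\tau_n}$ for all $i$; $\mathcal A$ is $\tau_n$-block diagonalizable if it has one, and uniquely $\tau_n$-block diagonalizable if moreover for any two $\tau_n$-block diagonalizers $W,\widetilde W$ there are a nonsingular $D\in\mathbb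 D_{\tau_n}$ and $\Pi\in\mathbb P_{\tau_n}$ with $\widetilde W=WD\Pi$. A family of $p\times p$ matrices can be further block diagonalized if it is $\tau_p$-block diagonalizable for some partition $\tau_p$ of $p$ with at least two parts. For a family $\mathcal B=\{B_i\}_{i=1}^m$ of real $p\times p$ matrices let $\mathscr N(\mathcal B)=\{Z\in\mathbb R^{p\times p}: B_iZ-Z^{\mathsf T}B_i=0,\ 1\le i\le m\}$. A matrix with $N$ columns has $N$ singular values, counted with multiplicity, and $\sigma_{\min}$ is the smallest of them. A minimum over an empty index set is $+\infty$. Statement. Let $W$ be a $\tau_n$-block diagonalizer of $\mathcal A$ with $\mathrm{Bdiag}_{\tau_n}(W^{\mathsf T}W)=I_n$, write $W^{\mathsf T}A_iW=\mathrm{diag}(A_i^{(11)},\dots,A_i^{(tt)})$, and let $\mathcal A_j=\{A_i^{(jj)}\}_{i=1}^m$. For $1\le j<k\le t$ let $G_{jk}$ be the matrix obtained by stacking, for $i=1,\dots,m$, $$\begin{bmatrix} I_{n_k}\otimes A_i^{(jj)} & (A_i^{(kk)})^{\mathsf T}\otimes I_{n_j}\\ I_{n_k}\otimes (A_i^{(jj)})^{\mathsf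 T} & A_i^{(kk)}\otimes I_{n_j}\end{bmatrix},$$ and for $1\le j\le t$ let $G_{jj}$ be the matrix obtained by stacking, for $i=1,\dots,m$, the matrices $I_{n_j}\otimes A_i^{(jj)}-\big[(A_i^{(jj)})^{\mathsf T}\otimes I_{n_j}\big]\Pi_j$, where $\Pi_j$ is the permutation matrix with $\Pi_j\,\mathrm{vec}(Z^{\mathsf T})=\mathrm{vec}(Z)$ for all $Z\in\mathbb R^{n_j\times n_j}$ and $\mathrm{vec}$ stacks columns. Put $$\omega_{\mathrm{uniq}}=\min_{1\le j<k\le t}\sigma_{\min}(G_{jk}),\qquad \omega_{\mathrm{robu}}=\min_{n_j>1}\{\text{the smallest nonzero singular value of }G_{jj}\}.$$ Suppose $\dim\mathscr N(\mathcal A_j)=1$ for all $1\le j\le t$, and for $n_j>1$ let $\sigma^{(j)}_{-2}$ be the second smallest singular value (counted with multiplicity) of $G_{jj}$. Then: (a) if $\omega_{\mathrm{uniq}}>0$, then $\mathcal A$ is uniquely $\tau_n$-block diagonalizable; (b) none of the $\mathcal A_j$ can be further block diagonalized, and $\omega_{\mathrm{robu}}=\min_{n_j>1}\sigma^{(j)}_{-2}>0$.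 -/

import Mathlib

open scoped Matrix Kronecker

namespace JBD

noncomputable section

/-! Partitions `τ = (n₁, …, n_t)` of `n` into positive integers, in this order, are Mathlib's
`Composition n`: `τ.length` is the cardinality `t`, `τ.blocksFun j` is `n_j`, `τ.index a` is the
block that contains the index `a`, and `τ.embedding j` enumerates the indices of block `j`. -/

/-- The block `A_{jk}` (of size `n_j × n_k`) of a matrix `A` partitioned according to `τ`. -/
def block {n : ℕ} (τ : Composition n) (A : Matrix (Fin n) (Fin n) ℝ) (j k : Fin τ.length) :
    Matrix (Fin (τ.blocksFun j)) (Fin (τ.blocksFun k)) ℝ :=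
  A.submatrix (τ.embedding j) (τ.embedding k)

/-- The block diagonal part `Bdiag_τ(A)`. -/
def bdiag {n : ℕ} (τ : Composition n) (A : Matrix (Fin n) (Fin n) ℝ) :
    Matrix (Fin n) (Fin n) ℝ :=
  Matrix.of fun a b => if τ.index a = τ.index b then A a b else 0

/-- The off-block diagonal part `OffBdiag_τ(A) = A - Bdiag_τ(A)`. -/
def offBdiag {n : ℕ} (τ : Composition n) (A : Matrix (Fin n) (Fin n) ℝ) :
    Matrix (Fin n) (Fin n) ℝ :=
  A - bdiag τ A

/-- The set `𝔻_τ` of `τ`-block diagonal matrices. -/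
def blockDiagonalSet {n : ℕ} (τ : Composition n) : Set (Matrix (Fin n) (Fin n) ℝ) :=
  {A | offBdiag τ A = 0}

/-- The set `ℙ_τ` of `τ`-block diagonal preserving permutation matrices. -/
def preservingPermSet {n : ℕ} (τ : Composition n) : Set (Matrix (Fin n) (Fin n) ℝ) :=
  {P | (∃ σ : Equiv.Perm (Fin n), P = σ.permMatrix ℝ) ∧
    ∀ D ∈ blockDiagonalSet τ, Pᵀ * D * P ∈ blockDiagonalSet τ}

/-- The set `𝕎_τ` of nonsingular `W` with `Bdiag_τ(Wᵀ W) = I`. -/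
def normalizedSet {n : ℕ} (τ : Composition n) : Set (Matrix (Fin n) (Fin n) ℝ) :=
  {W | IsUnit W ∧ bdiag τ (Wᵀ * W) = 1}

/-- `W` is a `τ`-block diagonalizer of the family `A`. -/
def IsBlockDiagonalizer {n m : ℕ} (τ : Composition n) (A : Fin m → Matrix (Fin n) (Fin n) ℝ)
    (W : Matrix (Fin n) (Fin n) ℝ) : Prop :=
  IsUnit W ∧ ∀ i, Wᵀ * A i * W ∈ blockDiagonalSet τ

/-- `A` is `τ`-block diagonalizable. -/
def IsBlockDiagonalizable {n m : ℕ} (τ : Composition n)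
    (A : Fin m → Matrix (Fin n) (Fin n) ℝ) : Prop :=
  ∃ W, IsBlockDiagonalizer τ A W

/-- Equivalence of block diagonalizers: `W' = W D P` with `D ∈ 𝔻_τ` nonsingular, `P ∈ ℙ_τ`. -/
def AreEquivalent {n : ℕ} (τ : Composition n) (W W' : Matrix (Fin n) (Fin n) ℝ) : Prop :=
  ∃ D ∈ blockDiagonalSet τ, IsUnit D ∧ ∃ P ∈ preservingPermSet τ, W' = W * D * P

/-- `A` is uniquely `τ`-block diagonalizable. -/
def IsUniquelyBlockDiagonalizable {n m : ℕ} (τ : Composition n)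
    (A : Fin m → Matrix (Fin n) (Fin n) ℝ) : Prop :=
  IsBlockDiagonalizable τ A ∧
    ∀ W W', IsBlockDiagonalizer τ A W → IsBlockDiagonalizer τ A W' → AreEquivalent τ W W'

/-- `A` can be further block diagonalized: it is block diagonalizable with respect to some
partition of its order into at least two parts. -/
def CanBeFurtherBlockDiagonalized {p m : ℕ} (A : Fin m → Matrix (Fin p) (Fin p) ℝ) : Prop :=
  ∃ τ : Composition p, 2 ≤ τ.length ∧ IsBlockDiagonalizable τ A

/-- The family `𝒜_j` of the `j`-th diagonal blocks `A_i^{(jj)}` of `Wᵀ A_i W`. -/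
def diagFamily {n m : ℕ} (τ : Composition n) (A : Fin m → Matrix (Fin n) (Fin n) ℝ)
    (W : Matrix (Fin n) (Fin n) ℝ) (j : Fin τ.length) :
    Fin m → Matrix (Fin (τ.blocksFun j)) (Fin (τ.blocksFun j)) ℝ :=
  fun i => block τ (Wᵀ * A i * W) j j

/-- The subspace `𝒩(𝒜) = {Z : A_i Z - Zᵀ A_i = 0 for all i}`. -/
def nullSpace {p m : ℕ} (A : Fin m → Matrix (Fin p) (Fin p) ℝ) :
    Submodule ℝ (Matrix (Fin p) (Fin p) ℝ) where
  carrier := {Z | ∀ i, A i * Z - Zᵀ * A i = 0}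
  zero_mem' := by intro i; simp
  add_mem' := by
    intro X Y hX hY i
    have h : A i * (X + Y) - (X + Y)ᵀ * A i
        = (A i * X - Xᵀ * A i) + (A i * Y - Yᵀ * A i) := by
      rw [Matrix.transpose_add, Matrix.mul_add, Matrix.add_mul]; abel
    rw [h, hX i, hY i, add_zero]
  smul_mem' := by
    intro r X hX i
    have h : A i * (r • X) - (r • X)ᵀ * A i = r • (A i * X - Xᵀ * A i) := by
      rw [Matrix.transpose_smul, Matrix.mul_smul, Matrix.smul_mul, smul_sub]
    rw [h, hX i, smul_zero]

/-- The matrix `G_{jk}` built from `B = 𝒜_j` (order `p`) and `C = 𝒜_k` (order `q`): its `i`-th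
block of rows is `[I_q ⊗ B_i, C_iᵀ ⊗ I_p; I_q ⊗ B_iᵀ, C_i ⊗ I_p]`. -/
def offDiagG {p q m : ℕ} (B : Fin m → Matrix (Fin p) (Fin p) ℝ)
    (C : Fin m → Matrix (Fin q) (Fin q) ℝ) :
    Matrix (Fin m × ((Fin q × Fin p) ⊕ (Fin q × Fin p))) ((Fin q × Fin p) ⊕ (Fin q × Fin p)) ℝ :=
  Matrix.of fun r s =>
    Matrix.fromBlocks
      ((1 : Matrix (Fin q) (Fin q) ℝ) ⊗ₖ B r.1) ((C r.1)ᵀ ⊗ₖ (1 : Matrix (Fin p) (Fin p) ℝ))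
      ((1 : Matrix (Fin q) (Fin q) ℝ) ⊗ₖ (B r.1)ᵀ) (C r.1 ⊗ₖ (1 : Matrix (Fin p) (Fin p) ℝ))
      r.2 s

/-- The perfect shuffle permutation matrix, `shuffle p *ᵥ vec Zᵀ = vec Z`. -/
def shuffle (p : ℕ) : Matrix (Fin p × Fin p) (Fin p × Fin p) ℝ :=
  Equiv.Perm.permMatrix ℝ (Equiv.prodComm (Fin p) (Fin p))

/-- The matrix `G_{jj}` built from `B = 𝒜_j` (order `p`): its `i`-th block of rows is
`I_p ⊗ B_i - (B_iᵀ ⊗ I_p) Π`, with `Π` the perfect shuffle. -/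
def diagG {p m : ℕ} (B : Fin m → Matrix (Fin p) (Fin p) ℝ) :
    Matrix (Fin m × (Fin p × Fin p)) (Fin p × Fin p) ℝ :=
  Matrix.of fun r s =>
    ((1 : Matrix (Fin p) (Fin p) ℝ) ⊗ₖ B r.1
      - ((B r.1)ᵀ ⊗ₖ (1 : Matrix (Fin p) (Fin p) ℝ)) * shuffle p) r.2 s

/-- The singular values of a real matrix `M`, in decreasing order and with multiplicity. There are
as many as `M` has columns (indices `0, …, N - 1` for `N` columns). -/
def singularValue {ρ κ : Type} [Fintype ρ] [Fintype κ] [DecidableEq κ]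
    (M : Matrix ρ κ ℝ) (i : ℕ) : ℝ :=
  (Matrix.toEuclideanLin M).singularValues i

/-- The smallest singular value `σ_min(M)` (for `M` with at least one column). -/
def sigmaMin {ρ κ : Type} [Fintype ρ] [Fintype κ] [DecidableEq κ] (M : Matrix ρ κ ℝ) : ℝ :=
  singularValue M (Fintype.card κ - 1)

/-- The second smallest singular value, counted with multiplicity (for `M` with at least two
columns). -/
def sigmaSecondMin {ρ κ : Type} [Fintype ρ] [Fintype κ] [DecidableEq κ] (M : Matrix ρ κ ℝ) : ℝ :=
  singularValue M (Fintype.card κ - 2)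

open Classical in
/-- The smallest nonzero singular value, as an extended real (`⊤` if `M = 0`). -/
def sigmaMinNonzero {ρ κ : Type} [Fintype ρ] [Fintype κ] [DecidableEq κ]
    (M : Matrix ρ κ ℝ) : EReal :=
  ((Finset.range (Fintype.card κ)).filter fun i => singularValue M i ≠ 0).inf
    fun i => (singularValue M i : EReal)

/-- The modulus of uniqueness `min_{j < k} σ_min(G_{jk})`, with value `⊤` if `t ≤ 1`. -/
def omegaUniq {n m : ℕ} (τ : Composition n) (A : Fin m → Matrix (Fin n) (Fin n) ℝ)
    (W : Matrix (Fin n) (Fin n) ℝ) : EReal :=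
  ((Finset.univ : Finset (Fin τ.length × Fin τ.length)).filter fun jk => jk.1 < jk.2).inf
    fun jk => (sigmaMin (offDiagG (diagFamily τ A W jk.1) (diagFamily τ A W jk.2)) : EReal)

/-- The modulus of non-divisibility: the minimum over the `j` with `n_j > 1` of the smallest
nonzero singular value of `G_{jj}`, with value `⊤` if all `n_j` are `1`. -/
def omegaRobu {n m : ℕ} (τ : Composition n) (A : Fin m → Matrix (Fin n) (Fin n) ℝ)
    (W : Matrix (Fin n) (Fin n) ℝ) : EReal :=
  ((Finset.univ : Finset (Fin τ.length)).filter fun j => 1 < τ.blocksFun j).inf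
    fun j => sigmaMinNonzero (diagG (diagFamily τ A W j))

/-- The minimum over the `j` with `n_j > 1` of the second smallest singular value of `G_{jj}`, with
value `⊤` if all `n_j` are `1`. -/
def minSigmaSecond {n m : ℕ} (τ : Composition n) (A : Fin m → Matrix (Fin n) (Fin n) ℝ)
    (W : Matrix (Fin n) (Fin n) ℝ) : EReal :=
  ((Finset.univ : Finset (Fin τ.length)).filter fun j => 1 < τ.blocksFun j).inf
    fun j => (sigmaSecondMin (diagG (diagFamily τ A W j)) : EReal)

end

end JBD

/-! Call a matrix block scalar if it is `diagonal (fun a => d (τ.index a))`. Whenever `V` block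
diagonalizes a family, each block scalar `S` commutes with the transformed family, so `V * S * V⁻¹`
lies in its `nullSpace`. If that space is the line spanned by `1`, two blocks are impossible: this
gives non-divisibility.

For uniqueness put `E i = Wᵀ * A i * W`. Injectivity of the `G_{jk}` kills the off-diagonal blocks
of any element of `nullSpace E`, and the dimension hypothesis makes its diagonal blocks scalar
(`mem_blockDiagonalSet_of_mem_nullSpace`, `exists_eq_diagonal_of_mem_nullSpace`). Hence changes of
basis between diagonalizers intertwine block scalar matrices; with distinct scalars this forces the
form `D * P` (`exists_eq_mul_permMatrix`).

For the moduli, `vec` identifies `nullSpace` with the kernel of `G_{jj}`, so exactly one singular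
value vanishes and the second smallest is the least nonzero one. -/

namespace JBD

open Matrix

/-! ### Block calculus, the space `nullSpace`, and non-divisibility. -/

section Blocks

variable {n m : ℕ} (τ : Composition n)

theorem mem_blockDiagonalSet_iff {A : Matrix (Fin n) (Fin n) ℝ} :
    A ∈ blockDiagonalSet τ ↔ ∀ a b, τ.index a ≠ τ.index b → A a b = 0 := by
  simp only [blockDiagonalSet, Set.mem_ofPred_eq, offBdiag, bdiag, ← Matrix.ext_iff,
    Matrix.sub_apply, Matrix.of_apply, Matrix.zero_apply]
  refine forall₂_congr fun a b => ?_
  by_cases h : τ.index a = τ.index b <;> simp [h]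

theorem block_transpose (A : Matrix (Fin n) (Fin n) ℝ) (j k : Fin τ.length) :
    block τ Aᵀ j k = (block τ A k j)ᵀ := rfl

theorem transpose_mem_blockDiagonalSet {A : Matrix (Fin n) (Fin n) ℝ}
    (hA : A ∈ blockDiagonalSet τ) : Aᵀ ∈ blockDiagonalSet τ := by
  rw [mem_blockDiagonalSet_iff] at hA ⊢
  exact fun a b hab => hA b a hab.symm

theorem block_mul_of_mem_left {D : Matrix (Fin n) (Fin n) ℝ} (hD : D ∈ blockDiagonalSet τ)
    (Z : Matrix (Fin n) (Fin n) ℝ) (j k : Fin τ.length) :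
    block τ (D * Z) j k = block τ D j j * block τ Z j k := by
  rw [mem_blockDiagonalSet_iff] at hD
  ext a b
  simp only [block, Matrix.submatrix_apply, Matrix.mul_apply]
  rw [← τ.blocksFinEquiv.sum_comp, Fintype.sum_sigma, Finset.sum_eq_single j]
  · rfl
  · intro l _ hl
    refine Finset.sum_eq_zero fun c _ => ?_
    have : D (τ.embedding j a) (τ.embedding l c) = 0 :=
      hD _ _ (by simpa only [τ.index_embedding] using hl.symm)
    change D (τ.embedding j a) (τ.embedding l c) * _ = 0
    rw [this, zero_mul]
  · simp

theorem block_mul_of_mem_right {D : Matrix (Fin n) (Fin n) ℝ} (hD : D ∈ blockDiagonalSet τ)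
    (Z : Matrix (Fin n) (Fin n) ℝ) (j k : Fin τ.length) :
    block τ (Z * D) j k = block τ Z j k * block τ D k k := by
  have h := block_mul_of_mem_left τ (transpose_mem_blockDiagonalSet τ hD) Zᵀ k j
  rw [← Matrix.transpose_mul] at h
  simpa only [block_transpose, ← Matrix.transpose_mul, Matrix.transpose_inj] using h

theorem mul_diagonal_comm_of_mem {D : Matrix (Fin n) (Fin n) ℝ} (hD : D ∈ blockDiagonalSet τ)
    (d : Fin τ.length → ℝ) :
    D * diagonal (fun a => d (τ.index a)) = diagonal (fun a => d (τ.index a)) * D := by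
  rw [mem_blockDiagonalSet_iff] at hD
  ext a b
  rw [Matrix.mul_diagonal, Matrix.diagonal_mul]
  by_cases h : τ.index a = τ.index b
  · rw [h, mul_comm]
  · rw [hD a b h, zero_mul, mul_zero]

theorem mem_nullSpace_iff {p : ℕ} {B : Fin m → Matrix (Fin p) (Fin p) ℝ}
    {Z : Matrix (Fin p) (Fin p) ℝ} : Z ∈ nullSpace B ↔ ∀ i, B i * Z = Zᵀ * B i :=
  forall_congr' fun _ => sub_eq_zero

theorem one_mem_nullSpace {p : ℕ} (B : Fin m → Matrix (Fin p) (Fin p) ℝ) :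
    (1 : Matrix (Fin p) (Fin p) ℝ) ∈ nullSpace B := by
  simp [mem_nullSpace_iff]

theorem conj_diagonal_mem_nullSpace {B : Fin m → Matrix (Fin n) (Fin n) ℝ}
    {V : Matrix (Fin n) (Fin n) ℝ} (hV : IsBlockDiagonalizer τ B V) (d : Fin τ.length → ℝ) :
    V * diagonal (fun a => d (τ.index a)) * V⁻¹ ∈ nullSpace B := by
  obtain ⟨hu, hB⟩ := hV
  have hdet := (Matrix.isUnit_iff_isUnit_det V).1 hu
  rw [mem_nullSpace_iff]
  intro i
  have h := mul_diagonal_comm_of_mem τ (hB i) d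
  apply hu.mul_right_cancel
  apply ((Matrix.isUnit_transpose V).2 hu).mul_left_cancel
  have e : Vᵀ * (V * diagonal (fun a => d (τ.index a)) * V⁻¹)ᵀ
      = diagonal (fun a => d (τ.index a)) * Vᵀ := by
    rw [← Matrix.transpose_mul, Matrix.mul_assoc, Matrix.nonsing_inv_mul _ hdet, Matrix.mul_one,
      Matrix.transpose_mul, Matrix.diagonal_transpose]
  calc Vᵀ * (B i * (V * diagonal (fun a => d (τ.index a)) * V⁻¹) * V)
      = Vᵀ * B i * V * diagonal (fun a => d (τ.index a)) * (V⁻¹ * V) := by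
        simp only [Matrix.mul_assoc]
    _ = Vᵀ * (V * diagonal (fun a => d (τ.index a)) * V⁻¹)ᵀ * B i * V := by
        rw [Matrix.nonsing_inv_mul _ hdet, Matrix.mul_one, h, e]
        simp only [Matrix.mul_assoc]
    _ = _ := by simp only [Matrix.mul_assoc]

theorem eq_smul_one_of_finrank_nullSpace_eq_one {p : ℕ} (hp : 0 < p)
    {B : Fin m → Matrix (Fin p) (Fin p) ℝ} (h : Module.finrank ℝ (nullSpace B) = 1)
    {Z : Matrix (Fin p) (Fin p) ℝ} (hZ : Z ∈ nullSpace B) : ∃ c : ℝ, Z = c • 1 := by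
  have : NeZero p := ⟨hp.ne'⟩
  have hne : (⟨1, one_mem_nullSpace B⟩ : nullSpace B) ≠ 0 := fun h0 =>
    one_ne_zero (congrArg Subtype.val h0)
  obtain ⟨c, hc⟩ := (finrank_eq_one_iff_of_nonzero' _ hne).1 h ⟨Z, hZ⟩
  exact ⟨c, (congrArg Subtype.val hc).symm⟩

theorem not_canBeFurtherBlockDiagonalized {p : ℕ} {B : Fin m → Matrix (Fin p) (Fin p) ℝ}
    (h : Module.finrank ℝ (nullSpace B) = 1) : ¬ CanBeFurtherBlockDiagonalized B := by
  rintro ⟨σ, hσ, V, hV⟩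
  have hp : 0 < p := σ.length_pos_iff.1 (by omega)
  have hdet := (Matrix.isUnit_iff_isUnit_det V).1 hV.1
  -- The scalars are the block numbers, so two blocks already contradict being a multiple of `1`.
  obtain ⟨c, hc⟩ := eq_smul_one_of_finrank_nullSpace_eq_one hp h
    (conj_diagonal_mem_nullSpace σ hV fun j => (j : ℝ))
  have hd : diagonal (fun a => ((σ.index a : ℕ) : ℝ)) = c • (1 : Matrix (Fin p) (Fin p) ℝ) := by
    apply hV.1.mul_left_cancel
    calc V * diagonal (fun a => ((σ.index a : ℕ) : ℝ))
        = V * diagonal (fun a => ((σ.index a : ℕ) : ℝ)) * V⁻¹ * V := by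
          rw [Matrix.mul_assoc _ V⁻¹, Matrix.nonsing_inv_mul _ hdet, Matrix.mul_one]
      _ = V * c • 1 := by rw [hc]; simp
  have hidx : ∀ j : Fin σ.length, ((j : ℕ) : ℝ) = c := by
    intro j
    have h1 := congrFun (congrFun hd (σ.embedding j ⟨0, σ.one_le_blocksFun j⟩))
      (σ.embedding j ⟨0, σ.one_le_blocksFun j⟩)
    simpa only [Matrix.diagonal_apply_eq, σ.index_embedding, Matrix.smul_apply,
      Matrix.one_apply_eq, smul_eq_mul, mul_one] using h1
  have h01 := (hidx ⟨0, by omega⟩).trans (hidx ⟨1, by omega⟩).symm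
  simp at h01

end Blocks

/-! ### Singular values and the dimension of the kernel. -/

section SingularValues

variable {ρ κ : Type} [Fintype κ] [DecidableEq κ]

theorem finrank_range_add_finrank_ker_mulVec (M : Matrix ρ κ ℝ) :
    Module.finrank ℝ (LinearMap.range (Matrix.toEuclideanLin M)) +
      Module.finrank ℝ (LinearMap.ker M.mulVecLin) = Fintype.card κ := by
  have e : Module.finrank ℝ (LinearMap.ker (Matrix.toEuclideanLin M))
      = Module.finrank ℝ (LinearMap.ker M.mulVecLin) := by
    refine LinearEquiv.finrank_eq
      ((WithLp.linearEquiv 2 ℝ (κ → ℝ)).submoduleMap _ |>.trans (LinearEquiv.ofEq _ _ ?_))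
    ext x
    simp only [Submodule.mem_map, LinearMap.mem_ker]
    constructor
    · rintro ⟨y, hy, rfl⟩
      simpa using congrArg WithLp.ofLp hy
    · intro hx
      refine ⟨WithLp.toLp 2 x, ?_, rfl⟩
      exact congrArg (WithLp.toLp 2) hx
  rw [← e, LinearMap.finrank_range_add_finrank_ker, finrank_euclideanSpace]

variable [Fintype ρ]

theorem eq_zero_of_sigmaMin_pos {M : Matrix ρ κ ℝ} (h : 0 < sigmaMin M) {x : κ → ℝ}
    (hx : M *ᵥ x = 0) : x = 0 := by
  rw [sigmaMin, singularValue, LinearMap.singularValues_pos_iff_lt_finrank_range] at h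
  have h1 := finrank_range_add_finrank_ker_mulVec M
  have h2 : LinearMap.ker M.mulVecLin = ⊥ := Submodule.finrank_eq_zero.1 (by omega)
  have h3 : x ∈ LinearMap.ker M.mulVecLin := hx
  simpa [h2] using h3

/-- The positive singular values are those with index below the rank, which is one less than the
number of columns. -/
theorem singularValue_pos_iff {M : Matrix ρ κ ℝ}
    (h : Module.finrank ℝ (LinearMap.ker M.mulVecLin) = 1) (i : ℕ) :
    0 < singularValue M i ↔ i < Fintype.card κ - 1 := by
  rw [singularValue, LinearMap.singularValues_pos_iff_lt_finrank_range]
  have h1 := finrank_range_add_finrank_ker_mulVec M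
  omega

theorem sigmaSecondMin_pos {M : Matrix ρ κ ℝ} (hκ : 1 < Fintype.card κ)
    (h : Module.finrank ℝ (LinearMap.ker M.mulVecLin) = 1) : 0 < sigmaSecondMin M :=
  (singularValue_pos_iff h _).2 (by omega)

theorem sigmaMinNonzero_eq_sigmaSecondMin {M : Matrix ρ κ ℝ} (hκ : 1 < Fintype.card κ)
    (h : Module.finrank ℝ (LinearMap.ker M.mulVecLin) = 1) :
    sigmaMinNonzero M = (sigmaSecondMin M : EReal) := by
  classical
  have hiff : ∀ i, singularValue M i ≠ 0 ↔ i < Fintype.card κ - 1 := fun i =>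
    (LinearMap.singularValues_pos_iff_ne_zero _ i).symm.trans (singularValue_pos_iff h i)
  -- The nonzero values have indices up to `card κ - 2`; by monotonicity the last is the least.
  refine le_antisymm (Finset.inf_le ?_) (Finset.le_inf fun i hi => ?_)
  · rw [Finset.mem_filter, Finset.mem_range, hiff]
    omega
  · rw [Finset.mem_filter, hiff] at hi
    exact EReal.coe_le_coe_iff.2 (LinearMap.singularValues_antitone _ (by omega))

end SingularValues

/-! ### Matrix equations behind `G_{jk}` and `G_{jj}`. -/

section Kronecker

variable {p q m : ℕ}

/-- Both rows of blocks are read through `(K ⊗ₖ L) *ᵥ vec X = vec (L * X * Kᵀ)`. -/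
theorem offDiagG_mulVec_eq_zero {B : Fin m → Matrix (Fin p) (Fin p) ℝ}
    {C : Fin m → Matrix (Fin q) (Fin q) ℝ} {X Y : Matrix (Fin p) (Fin q) ℝ}
    (h₁ : ∀ i, B i * X + Y * C i = 0) (h₂ : ∀ i, (B i)ᵀ * X + Y * (C i)ᵀ = 0) :
    offDiagG B C *ᵥ Sum.elim (vec X) (vec Y) = 0 := by
  funext r
  obtain ⟨i, r⟩ := r
  change (Matrix.fromBlocks
      ((1 : Matrix (Fin q) (Fin q) ℝ) ⊗ₖ B i) ((C i)ᵀ ⊗ₖ (1 : Matrix (Fin p) (Fin p) ℝ))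
      ((1 : Matrix (Fin q) (Fin q) ℝ) ⊗ₖ (B i)ᵀ) (C i ⊗ₖ (1 : Matrix (Fin p) (Fin p) ℝ))
      *ᵥ Sum.elim (vec X) (vec Y)) r = 0
  rw [Matrix.fromBlocks_mulVec]
  simp only [Sum.elim_comp_inl, Sum.elim_comp_inr, Matrix.kronecker_mulVec_vec, ← Matrix.vec_add,
    Matrix.transpose_one, Matrix.mul_one, Matrix.one_mul, Matrix.transpose_transpose, h₁, h₂]
  cases r <;> rfl

theorem shuffle_mulVec_vec (Z : Matrix (Fin p) (Fin p) ℝ) : shuffle p *ᵥ vec Z = vec Zᵀ := by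
  rw [shuffle, Matrix.permMatrix_mulVec]
  rfl

theorem diagG_mulVec_vec (B : Fin m → Matrix (Fin p) (Fin p) ℝ) (Z : Matrix (Fin p) (Fin p) ℝ)
    (i : Fin m) (r : Fin p × Fin p) :
    (diagG B *ᵥ vec Z) (i, r) = vec (B i * Z - Zᵀ * B i) r := by
  change (((1 : Matrix (Fin p) (Fin p) ℝ) ⊗ₖ B i
      - ((B i)ᵀ ⊗ₖ (1 : Matrix (Fin p) (Fin p) ℝ)) * shuffle p) *ᵥ vec Z) r = _
  rw [Matrix.sub_mulVec, ← Matrix.mulVec_mulVec, shuffle_mulVec_vec, Matrix.kronecker_mulVec_vec,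
    Matrix.kronecker_mulVec_vec, ← Matrix.vec_sub]
  simp

theorem diagG_mulVec_vec_eq_zero_iff {B : Fin m → Matrix (Fin p) (Fin p) ℝ}
    {Z : Matrix (Fin p) (Fin p) ℝ} : diagG B *ᵥ vec Z = 0 ↔ Z ∈ nullSpace B := by
  change _ ↔ ∀ i, B i * Z - Zᵀ * B i = 0
  simp_rw [← Matrix.vec_eq_zero_iff, funext_iff, Prod.forall (α := Fin m), diagG_mulVec_vec]
  rfl

/-- Vectorization as a linear equivalence. -/
noncomputable def vecLinearEquiv (p : ℕ) : Matrix (Fin p) (Fin p) ℝ ≃ₗ[ℝ] (Fin p × Fin p → ℝ) :=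
  LinearEquiv.ofBijective
    { toFun := vec, map_add' := Matrix.vec_add, map_smul' := Matrix.vec_smul }
    Matrix.vec_bijective

theorem finrank_ker_diagG (B : Fin m → Matrix (Fin p) (Fin p) ℝ) :
    Module.finrank ℝ (LinearMap.ker (diagG B).mulVecLin) = Module.finrank ℝ (nullSpace B) := by
  refine (LinearEquiv.finrank_eq
    ((vecLinearEquiv p).submoduleMap _ |>.trans (LinearEquiv.ofEq _ _ ?_))).symm
  ext x
  obtain ⟨Z, rfl⟩ := (vecLinearEquiv p).surjective x
  refine (Submodule.mem_map_equiv _).trans ?_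
  rw [LinearEquiv.symm_apply_apply]
  exact diagG_mulVec_vec_eq_zero_iff.symm

end Kronecker

/-! ### Intertwiners of block scalar matrices and uniqueness. -/

section Uniqueness

variable {n m : ℕ} (τ : Composition n)

/-- Some term of the Leibniz expansion of a nonzero determinant is nonzero. -/
theorem exists_perm_forall_apply_ne_zero {V : Matrix (Fin n) (Fin n) ℝ} (hV : IsUnit V) :
    ∃ σ : Equiv.Perm (Fin n), ∀ a, V a (σ a) ≠ 0 := by
  have hdet : V.det ≠ 0 := ((Matrix.isUnit_iff_isUnit_det V).1 hV).ne_zero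
  by_contra! hcon
  apply hdet
  rw [← Matrix.det_transpose, Matrix.det_apply]
  refine Finset.sum_eq_zero fun σ _ => ?_
  obtain ⟨a, ha⟩ := hcon σ
  rw [Finset.prod_eq_zero (Finset.mem_univ a) (by simpa using ha), smul_zero]

theorem index_surjective : Function.Surjective τ.index := fun j =>
  ⟨τ.embedding j ⟨0, τ.one_le_blocksFun j⟩, τ.index_embedding _ _⟩

theorem permMatrix_mem_preservingPermSet {σ : Equiv.Perm (Fin n)}
    (hσ : ∀ a b, τ.index (σ a) = τ.index (σ b) → τ.index a = τ.index b) :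
    σ.permMatrix ℝ ∈ preservingPermSet τ := by
  have hex : ∀ j, ∃ k, ∀ b, τ.index (σ b) = j → τ.index b = k := fun j => by
    obtain ⟨a, rfl⟩ := index_surjective τ j
    refine ⟨τ.index (σ.symm a), fun b hb => hσ _ _ ?_⟩
    rw [hb, σ.apply_symm_apply]
  choose f hf using hex
  -- `f` is the map that `σ⁻¹` induces on blocks. It is onto a finite set of the same size, so `σ⁻¹`
  -- also keeps distinct blocks apart.
  have hfi : Function.Injective f := by
    refine Finite.injective_iff_surjective.2 fun k => ?_
    obtain ⟨b, rfl⟩ := index_surjective τ k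
    exact ⟨τ.index (σ b), (hf _ b rfl).symm⟩
  refine ⟨⟨σ, rfl⟩, fun D hD => ?_⟩
  rw [mem_blockDiagonalSet_iff] at hD ⊢
  intro a b hab
  have e : ((σ.permMatrix ℝ)ᵀ * D * σ.permMatrix ℝ) a b = D (σ.symm a) (σ.symm b) := by
    rw [Matrix.transpose_permMatrix, Equiv.Perm.permMatrix, Equiv.Perm.permMatrix,
      PEquiv.toMatrix_toPEquiv_mul, PEquiv.mul_toMatrix_toPEquiv]
    rfl
  rw [e]
  refine hD _ _ fun h => hab (hfi ?_)
  rw [← hf _ (σ.symm a) (by rw [σ.apply_symm_apply]), ← hf _ (σ.symm b)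
    (by rw [σ.apply_symm_apply]), h]

theorem apply_eq_of_diagonal_mul_eq {V : Matrix (Fin n) (Fin n) ℝ} {c d : Fin τ.length → ℝ}
    (h : diagonal (fun a => c (τ.index a)) * V = V * diagonal (fun a => d (τ.index a)))
    {a b : Fin n} (hab : V a b ≠ 0) : c (τ.index a) = d (τ.index b) := by
  have := congrFun (congrFun h a) b
  rw [Matrix.diagonal_mul, Matrix.mul_diagonal, mul_comm] at this
  exact mul_left_cancel₀ hab this

/-- A nonsingular matrix that intertwines two block scalar matrices, the second with distinct
scalars, is a block diagonal matrix times a block preserving permutation. -/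
theorem exists_eq_mul_permMatrix {V : Matrix (Fin n) (Fin n) ℝ} (hV : IsUnit V)
    {c d : Fin τ.length → ℝ} (hd : Function.Injective d)
    (h : diagonal (fun a => c (τ.index a)) * V = V * diagonal (fun a => d (τ.index a))) :
    ∃ D ∈ blockDiagonalSet τ, IsUnit D ∧ ∃ P ∈ preservingPermSet τ, V = D * P := by
  have hcd : ∀ a b, V a b ≠ 0 → c (τ.index a) = d (τ.index b) :=
    fun a b => apply_eq_of_diagonal_mul_eq τ h
  obtain ⟨σ, hσ⟩ := exists_perm_forall_apply_ne_zero hV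
  have hpush : ∀ a b, τ.index a = τ.index b → τ.index (σ a) = τ.index (σ b) := fun a b hab =>
    hd (by rw [← hcd a _ (hσ a), ← hcd b _ (hσ b), hab])
  -- By `hpush`, `σ` induces a map on blocks; it is surjective, hence injective by finiteness.
  have hpull : ∀ a b, τ.index (σ a) = τ.index (σ b) → τ.index a = τ.index b := by
    choose s hs using index_surjective τ
    have hinj : Function.Injective fun j => τ.index (σ (s j)) := by
      refine Finite.injective_iff_surjective.2 fun k => ?_
      obtain ⟨a, rfl⟩ := index_surjective τ k
      refine ⟨τ.index (σ.symm a), ?_⟩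
      rw [← hpush _ _ (hs (τ.index (σ.symm a))).symm, σ.apply_symm_apply]
    intro a b hab
    apply hinj
    change τ.index (σ (s _)) = τ.index (σ (s _))
    rw [hpush _ _ (hs (τ.index a)), hpush _ _ (hs (τ.index b)), hab]
  refine ⟨V.submatrix id σ, ?_, ?_, σ.permMatrix ℝ, permMatrix_mem_preservingPermSet τ hpull, ?_⟩
  · rw [mem_blockDiagonalSet_iff]
    intro a b hab
    by_contra hne
    exact hab (hpull _ _ (hd (by rw [← hcd a _ (hσ a), ← hcd a _ hne])))
  · exact (Matrix.isUnit_submatrix_equiv (Equiv.refl _) σ).2 hV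
  · rw [Equiv.Perm.permMatrix, PEquiv.mul_toMatrix_toPEquiv]
    ext a b
    simp

theorem mem_blockDiagonalSet_of_mem_nullSpace {E : Fin m → Matrix (Fin n) (Fin n) ℝ}
    (hE : ∀ i, E i ∈ blockDiagonalSet τ)
    (hpos : ∀ j k : Fin τ.length, j < k →
      0 < sigmaMin (offDiagG (fun i => block τ (E i) j j) (fun i => block τ (E i) k k)))
    {Z : Matrix (Fin n) (Fin n) ℝ} (hZ : Z ∈ nullSpace E) : Z ∈ blockDiagonalSet τ := by
  rw [mem_nullSpace_iff] at hZ
  have hblock : ∀ i j k, block τ (E i) j j * block τ Z j k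
      = (block τ Z k j)ᵀ * block τ (E i) k k := fun i j k => by
    rw [← block_mul_of_mem_left τ (hE i), hZ i, block_mul_of_mem_right τ (hE i), block_transpose]
  have hzero : ∀ j k : Fin τ.length, j < k → block τ Z j k = 0 ∧ block τ Z k j = 0 := by
    intro j k hjk
    -- The `(j, k)` equation and the transposed `(k, j)` equation form one homogeneous system in
    -- `Z_{jk}` and `-Z_{kj}ᵀ`, with coefficient matrix `G_{jk}`.
    have h0 := eq_zero_of_sigmaMin_pos (hpos j k hjk)
      (offDiagG_mulVec_eq_zero (X := block τ Z j k) (Y := -(block τ Z k j)ᵀ)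
        (fun i => by rw [hblock, Matrix.neg_mul, add_neg_cancel])
        (fun i => by
          have := congrArg Matrix.transpose (hblock i k j)
          rw [Matrix.transpose_mul, Matrix.transpose_mul, Matrix.transpose_transpose] at this
          rw [Matrix.neg_mul, this, add_neg_cancel]))
    constructor
    · rw [← Matrix.vec_eq_zero_iff]
      funext r
      exact congrFun h0 (Sum.inl r)
    · rw [← Matrix.transpose_eq_zero, ← neg_eq_zero, ← Matrix.vec_eq_zero_iff]
      funext r
      exact congrFun h0 (Sum.inr r)
  rw [mem_blockDiagonalSet_iff]
  intro a b hab
  have hz : block τ Z (τ.index a) (τ.index b) = 0 :=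
    (lt_or_gt_of_ne hab).elim (fun h => (hzero _ _ h).1) (fun h => (hzero _ _ h).2)
  have := congrFun (congrFun hz (τ.invEmbedding a)) (τ.invEmbedding b)
  simpa only [block, Matrix.submatrix_apply, Matrix.zero_apply, τ.embedding_comp_inv] using this

theorem exists_eq_diagonal_of_mem_nullSpace {E : Fin m → Matrix (Fin n) (Fin n) ℝ}
    (hE : ∀ i, E i ∈ blockDiagonalSet τ)
    (hdim : ∀ j, Module.finrank ℝ (nullSpace fun i => block τ (E i) j j) = 1)
    {Z : Matrix (Fin n) (Fin n) ℝ} (hZ : Z ∈ nullSpace E) (hZb : Z ∈ blockDiagonalSet τ) :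
    ∃ c : Fin τ.length → ℝ, Z = diagonal fun a => c (τ.index a) := by
  rw [mem_nullSpace_iff] at hZ
  have hmem : ∀ j, block τ Z j j ∈ nullSpace fun i => block τ (E i) j j := fun j => by
    rw [mem_nullSpace_iff]
    intro i
    rw [← block_mul_of_mem_left τ (hE i), hZ i, block_mul_of_mem_right τ (hE i), block_transpose]
  choose c hc using fun j =>
    eq_smul_one_of_finrank_nullSpace_eq_one (τ.one_le_blocksFun j) (hdim j) (hmem j)
  refine ⟨c, ?_⟩
  have hentry : ∀ j x y, Z (τ.embedding j x) (τ.embedding j y)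
      = diagonal (fun a => c (τ.index a)) (τ.embedding j x) (τ.embedding j y) := fun j x y => by
    have := congrFun (congrFun (hc j) x) y
    rw [block, Matrix.submatrix_apply] at this
    rw [this, Matrix.smul_apply, Matrix.one_apply, Matrix.diagonal_apply, τ.index_embedding]
    simp
  ext a b
  obtain ⟨x, hx⟩ := τ.mem_range_embedding a
  by_cases hab : τ.index a = τ.index b
  · obtain ⟨y, hy⟩ := τ.mem_range_embedding_iff'.2 hab
    rw [← hx, ← hy]
    exact hentry _ _ _
  · rw [(mem_blockDiagonalSet_iff τ).1 hZb a b hab,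
      Matrix.diagonal_apply_ne _ fun h => hab (congrArg _ h)]

/-- Under the spectral hypotheses at one block diagonalizer `W`, the change of basis from `W` to any
other one turns block scalar matrices into block scalar matrices. -/
theorem exists_diagonal_mul_eq_of_isBlockDiagonalizer {A : Fin m → Matrix (Fin n) (Fin n) ℝ}
    {W W' : Matrix (Fin n) (Fin n) ℝ} (hW : IsBlockDiagonalizer τ A W)
    (hdim : ∀ j, Module.finrank ℝ (nullSpace (diagFamily τ A W j)) = 1)
    (hpos : ∀ j k : Fin τ.length, j < k →
      0 < sigmaMin (offDiagG (diagFamily τ A W j) (diagFamily τ A W k)))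
    (hW' : IsBlockDiagonalizer τ A W') (d : Fin τ.length → ℝ) :
    ∃ c : Fin τ.length → ℝ, diagonal (fun a => c (τ.index a)) * (W⁻¹ * W')
      = W⁻¹ * W' * diagonal (fun a => d (τ.index a)) := by
  have hdet := (Matrix.isUnit_iff_isUnit_det W).1 hW.1
  have hWV : W * (W⁻¹ * W') = W' := by
    rw [← Matrix.mul_assoc, Matrix.mul_nonsing_inv _ hdet, Matrix.one_mul]
  have hV : IsBlockDiagonalizer τ (fun i => Wᵀ * A i * W) (W⁻¹ * W') := by
    refine ⟨((Matrix.isUnit_nonsing_inv_iff).2 hW.1).mul hW'.1, fun i => ?_⟩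
    have e : (W⁻¹ * W')ᵀ * (Wᵀ * A i * W) * (W⁻¹ * W')
        = (W * (W⁻¹ * W'))ᵀ * A i * (W * (W⁻¹ * W')) := by
      rw [Matrix.transpose_mul W]
      simp only [Matrix.mul_assoc]
    rw [e, hWV]
    exact hW'.2 i
  have hZ := conj_diagonal_mem_nullSpace τ hV d
  obtain ⟨c, hc⟩ := exists_eq_diagonal_of_mem_nullSpace τ hW.2 hdim hZ
    (mem_blockDiagonalSet_of_mem_nullSpace τ hW.2 hpos hZ)
  have hVdet := (Matrix.isUnit_iff_isUnit_det _).1 hV.1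
  refine ⟨c, ?_⟩
  rw [← hc, Matrix.mul_assoc _ (W⁻¹ * W')⁻¹, Matrix.nonsing_inv_mul _ hVdet, Matrix.mul_one]

/-- The values of `c` are a rearrangement of the distinct values of `d`, so `V` matches blocks
bijectively, and any other block scalars can be carried along the same matching `s`. -/
theorem exists_diagonal_mul_eq_mul_diagonal {V : Matrix (Fin n) (Fin n) ℝ} (hV : IsUnit V)
    {c d : Fin τ.length → ℝ} (hd : Function.Injective d)
    (h : diagonal (fun a => c (τ.index a)) * V = V * diagonal (fun a => d (τ.index a)))
    (e : Fin τ.length → ℝ) : ∃ e' : Fin τ.length → ℝ,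
      diagonal (fun a => e (τ.index a)) * V = V * diagonal (fun a => e' (τ.index a)) := by
  have hcd : ∀ a b, V a b ≠ 0 → c (τ.index a) = d (τ.index b) :=
    fun a b => apply_eq_of_diagonal_mul_eq τ h
  obtain ⟨σ, hσ⟩ := exists_perm_forall_apply_ne_zero hV
  have hex : ∀ j, ∃ k, c k = d j := fun j => by
    obtain ⟨b, rfl⟩ := index_surjective τ j
    exact ⟨τ.index (σ.symm b), by simpa using hcd _ _ (hσ (σ.symm b))⟩
  choose s hs using hex
  have hsurj : Function.Surjective s := Finite.injective_iff_surjective.1 fun j k hjk =>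
    hd (by rw [← hs, ← hs, hjk])
  refine ⟨fun j => e (s j), ?_⟩
  ext a b
  rw [Matrix.diagonal_mul, Matrix.mul_diagonal, mul_comm]
  by_cases hab : V a b = 0
  · rw [hab, zero_mul, zero_mul]
  · obtain ⟨j, hj⟩ := hsurj (τ.index a)
    have hjb : j = τ.index b := hd (by rw [← hs, hj, hcd a b hab])
    rw [← hj, hjb]

theorem isUniquelyBlockDiagonalizable_of_sigmaMin_pos {A : Fin m → Matrix (Fin n) (Fin n) ℝ}
    {W : Matrix (Fin n) (Fin n) ℝ} (hW : IsBlockDiagonalizer τ A W)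
    (hdim : ∀ j, Module.finrank ℝ (nullSpace (diagFamily τ A W j)) = 1)
    (hpos : ∀ j k : Fin τ.length, j < k →
      0 < sigmaMin (offDiagG (diagFamily τ A W j) (diagFamily τ A W k))) :
    IsUniquelyBlockDiagonalizable τ A := by
  refine ⟨⟨W, hW⟩, fun W₁ W₂ h₁ h₂ => ?_⟩
  have hWi := (Matrix.isUnit_nonsing_inv_iff).2 hW.1
  have hV₁ := hWi.mul h₁.1
  have hV₂ := hWi.mul h₂.1
  let d : Fin τ.length → ℝ := fun j => (j : ℕ)
  have hd : Function.Injective d := fun j k hjk => Fin.ext (Nat.cast_injective hjk)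
  obtain ⟨c₁, hc₁⟩ := exists_diagonal_mul_eq_of_isBlockDiagonalizer τ hW hdim hpos h₁ d
  obtain ⟨c₂, hc₂⟩ := exists_diagonal_mul_eq_of_isBlockDiagonalizer τ hW hdim hpos h₂ d
  -- The hypotheses concern `W` only, so `W₁` and `W₂` are compared through it: the scalars `c₂`
  -- obtained from `W₂` are moved across `W⁻¹ * W₁`.
  obtain ⟨c, hc⟩ := exists_diagonal_mul_eq_mul_diagonal τ hV₁ hd hc₁ c₂
  have hdet₁ := (Matrix.isUnit_iff_isUnit_det _).1 h₁.1
  have h₁₂ : W₁ * (W₁⁻¹ * W₂) = W₂ := by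
    rw [← Matrix.mul_assoc, Matrix.mul_nonsing_inv _ hdet₁, Matrix.one_mul]
  have hU : W⁻¹ * W₁ * (W₁⁻¹ * W₂) = W⁻¹ * W₂ := by rw [Matrix.mul_assoc, h₁₂]
  have hcU : diagonal (fun a => c (τ.index a)) * (W₁⁻¹ * W₂)
      = W₁⁻¹ * W₂ * diagonal (fun a => d (τ.index a)) := by
    apply hV₁.mul_left_cancel
    rw [← Matrix.mul_assoc, ← hc, Matrix.mul_assoc, hU, hc₂, ← Matrix.mul_assoc, hU]
  obtain ⟨D, hD, hDu, P, hP, hDP⟩ := exists_eq_mul_permMatrix τ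
    (((Matrix.isUnit_nonsing_inv_iff).2 h₁.1).mul h₂.1) hd hcU
  refine ⟨D, hD, hDu, P, hP, ?_⟩
  rw [Matrix.mul_assoc, ← hDP, h₁₂]

end Uniqueness

theorem sigmaMin_pos_of_omegaUniq_pos {n m : ℕ} {τ : Composition n}
    {A : Fin m → Matrix (Fin n) (Fin n) ℝ} {W : Matrix (Fin n) (Fin n) ℝ}
    (h : 0 < omegaUniq τ A W) (j k : Fin τ.length) (hjk : j < k) :
    0 < sigmaMin (offDiagG (diagFamily τ A W j) (diagFamily τ A W k)) := by
  have hle : omegaUniq τ A W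
      ≤ (sigmaMin (offDiagG (diagFamily τ A W j) (diagFamily τ A W k)) : EReal) :=
    Finset.inf_le (b := (j, k)) (Finset.mem_filter.2 ⟨Finset.mem_univ _, hjk⟩)
  exact EReal.coe_pos.1 (h.trans_le hle)

end JBD

theorem corollary2p3 {n m : ℕ} (τ : Composition n) (A : Fin m → Matrix (Fin n) (Fin n) ℝ)
    (W : Matrix (Fin n) (Fin n) ℝ) (hW : W ∈ JBD.normalizedSet τ)
    (hAW : JBD.IsBlockDiagonalizer τ A W)
    (hdim : ∀ j : Fin τ.length,
      Module.finrank ℝ (JBD.nullSpace (JBD.diagFamily τ A W j)) = 1) :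
    (0 < JBD.omegaUniq τ A W → JBD.IsUniquelyBlockDiagonalizable τ A) ∧
    ((∀ j : Fin τ.length, ¬ JBD.CanBeFurtherBlockDiagonalized (JBD.diagFamily τ A W j)) ∧
      JBD.omegaRobu τ A W = JBD.minSigmaSecond τ A W ∧
      0 < JBD.minSigmaSecond τ A W) := by
  have hcard : ∀ j : Fin τ.length, 1 < τ.blocksFun j →
      1 < Fintype.card (Fin (τ.blocksFun j) × Fin (τ.blocksFun j)) := fun j hj => by
    rw [Fintype.card_prod, Fintype.card_fin]
    exact hj.trans_le (Nat.le_mul_self _)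
  have hker := fun j => (JBD.finrank_ker_diagG (JBD.diagFamily τ A W j)).trans (hdim j)
  refine ⟨fun h => JBD.isUniquelyBlockDiagonalizable_of_sigmaMin_pos τ hAW hdim
    (JBD.sigmaMin_pos_of_omegaUniq_pos h),
    fun j => JBD.not_canBeFurtherBlockDiagonalized (hdim j), ?_, ?_⟩
  · exact Finset.inf_congr rfl fun j hj => JBD.sigmaMinNonzero_eq_sigmaSecondMin
      (hcard j (Finset.mem_filter.1 hj).2) (hker j)
  -- `EReal.zero_lt_top` covers the case where every block has size `1` and the minimum is `⊤`.
  · refine (Finset.lt_inf_iff EReal.zero_lt_top).2 fun j hj => EReal.coe_pos.2 ?_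
    exact JBD.sigmaSecondMin_pos (hcard j (Finset.mem_filter.1 hj).2) (hker j)
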